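/- For a finite simple graph $G=(V,E)$, let $P(G)$ be the poset on the disjoint union $V\cup E$ in which $v<e$ exactly when $v\in V$, $e\in E$ and the edge $e$ is incident to the vertex $v$, and no other two distinct elements are comparable. A family $\mathcal F$ of subsets of $[n]=\{1,\dots,n\}$ contains a poset $H$ if there is an injection $f\colon H\to\mathcal F$ such that $u\le v$ in $H$ implies $f(u)\subseteq f(v)$; otherwise $\mathcal F$ is $H$-free. Let $\mathrm{La}(n,H)$ denote the largest size of an $H$-free family of subsets of $[n]$. Theorem. Let $G$ be a finite simple graph with at least one edge, and let $\chi(G)$ be its chromatic number. Then, as $n\to\infty$ with $G$ fixed, $$\mathrm{La}(n,P(G))\le\left(1+\sqrt{1-\frac{1}{\chi(G)-1}}+o(1)\right)\binom{n}{\lfloor n/2\rfloor}.$$ In particular, if $G$ is bipartite, then $$\mathrm{La}(n,P(G))=(1+o(1))\binom{n}{\lfloor n/2\rfloor}.$$ -/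

import Mathlib

open Filter Topology

/-- The poset `S` contains `S'` as a (not necessarily induced) subposet: there is an injection
`S' → S` that preserves the order. -/
def ContainsSubposet (S S' : Type*) [PartialOrder S] [PartialOrder S'] : Prop :=
  ∃ f : S' → S, Function.Injective f ∧ ∀ u v : S', u ≤ v → f u ≤ f v

/-- A family `F` of subsets of an `n`-element set is `H`-free if the poset `(F, ⊆)` does not
contain `H` as a subposet. -/
def IsPosetFree {n : ℕ} (F : Finset (Finset (Fin n))) (H : Type*) [PartialOrder H] : Prop :=
  ¬ ContainsSubposet {A : Finset (Fin n) // A ∈ F} H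

open Classical in
/-- `La n H` is the largest size of an `H`-free family of subsets of an `n`-element set
(for nonempty `H` the empty family is always `H`-free, so this is a maximum). -/
noncomputable def La (n : ℕ) (H : Type*) [PartialOrder H] : ℕ :=
  (Finset.univ.filter fun F : Finset (Finset (Fin n)) => IsPosetFree F H).sup Finset.card

/-- The set `V ∪ E` of vertices and edges of the simple graph `G`. -/
inductive GraphPoset {V : Type*} (G : SimpleGraph V) where
  | vertex (v : V) : GraphPoset G
  | edge (e : G.edgeSet) : GraphPoset G

namespace GraphPoset

variable {V : Type*} {G : SimpleGraph V}

/-- The order of `P(G)`: equality, together with `v ≤ e` when the edge `e` is incident to `v`. -/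
protected inductive Le : GraphPoset G → GraphPoset G → Prop
  | refl (x : GraphPoset G) : GraphPoset.Le x x
  | incident (v : V) (e : G.edgeSet) (h : v ∈ (e : Sym2 V)) :
      GraphPoset.Le (vertex v) (edge e)

instance : PartialOrder (GraphPoset G) where
  le := GraphPoset.Le
  le_refl := GraphPoset.Le.refl
  le_trans := by
    intro a b c hab hbc
    cases hab with
    | refl => exact hbc
    | incident v e h =>
      cases hbc with
      | refl => exact GraphPoset.Le.incident v e h
  le_antisymm := by
    intro a b hab hba
    cases hab with
    | refl => rfl
    | incident v e h => cases hba

end GraphPoset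

/-! Chernoff's bound makes sets far from the middle size negligible, so it suffices to bound the
Lubell weight of the rest of the family F: the expected number of its members on a random full
chain. Put s = |V| + |E|. No set has more than s members below it and more than s above it, since V
placed below and E above would form P(G) (`IsPosetFree.few_below_or_few_above`). So F splits into A,
whose members have at most s members below, and B, whose members have at most s above. Given that a
chain passes through a central S, it meets another fixed set comparable to S (not empty or full)
with probability O(1/n). Hence A and B each have weight at most 1 + o(1), and gaps between
successive members on a chain contribute only O(δs) + o(1), where δn is the width of the central
band (`lubell_le_of_few_below_or_above`). The excess over 1 comes from the pairs S \ {x} ∈ A, S ∈ B.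

Let q(S) be the proportion of x ∈ S with S \ {x} ∈ A. By Cauchy–Schwarz the weighted sum of q over B
is controlled by that of q². The latter counts pairs x, y, that is, edges of link graphs: for D = S
\ {x, y}, the vertices are the x with D ∪ {x} ∈ A and the edges the xy with D ∪ {x, y} ∈ B. A copy
of G in a link graph is a copy of P(G) in F (`IsPosetFree.free_linkGraph`), so Erdős–Stone bounds
the second moment by 1 - 1/(χ(G) - 1) + o(1) (`sum_sq_consecutive_le`), and the excess by its square
root. For bipartite G the root vanishes and the middle layer gives the lower bound. -/

section GraphPosetBound

open Finset Numbering

/-! ### Random full chains, modelled by numberings of the ground set. -/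

section Chains

variable {α : Type*} [Fintype α] [DecidableEq α]

/-- The Lubell weight of a family: the expected number of members on a random full chain. -/
noncomputable def lubell (F : Finset (Finset α)) : ℝ :=
  ∑ S ∈ F, ((Fintype.card α).choose #S : ℝ)⁻¹

open Classical in
/-- The proportion of numberings with a given property. -/
noncomputable def chainProb (p : Numbering α → Prop) : ℝ :=
  (#{f | p f} : ℝ) / (Fintype.card α).factorial

theorem chainProb_eq_card_div {p : Numbering α → Prop} (s : Finset (Numbering α))
    (h : ∀ f, f ∈ s ↔ p f) : chainProb p = (#s : ℝ) / (Fintype.card α).factorial := by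
  classical
  unfold chainProb
  congr 3
  ext f
  simp [h]

theorem chainProb_mono {p q : Numbering α → Prop} (h : ∀ f, p f → q f) :
    chainProb p ≤ chainProb q := by
  classical
  unfold chainProb
  gcongr with f
  exact h f

theorem chainProb_exists_le {ι : Type*} (s : Finset ι) (p : ι → Numbering α → Prop) :
    chainProb (fun f => ∃ i ∈ s, p i f) ≤ ∑ i ∈ s, chainProb (p i) := by
  classical
  unfold chainProb
  rw [← sum_div]
  gcongr
  have : ({f | ∃ i ∈ s, p i f} : Finset (Numbering α)) = s.biUnion fun i => {f | p i f} := by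
    ext f; simp
  calc _ = (#(s.biUnion fun i => ({f | p i f} : Finset (Numbering α))) : ℝ) := by
        rw [← this]; congr!
    _ ≤ _ := by exact_mod_cast card_biUnion_le

theorem chainProb_isPrefix (S : Finset α) :
    chainProb (fun f => f.IsPrefix S) = ((Fintype.card α).choose #S : ℝ)⁻¹ := by
  rw [chainProb_eq_card_div (prefixed S) (fun f => mem_prefixed), card_prefixed,
    Nat.cast_choose ℝ S.card_le_univ, inv_div]
  push_cast
  rfl

/-- A numbering with both prefixes orders A, then S \ A, then the complement of S, independently. -/
theorem card_prefixed_inter_prefixed_le {A S : Finset α} (h : A ⊆ S) :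
    #(prefixed A ∩ prefixed S) ≤
      (#A).factorial * (#S - #A).factorial * (Fintype.card α - #S).factorial := by
  have hA : #(A.subtype (· ∈ S)) = #A := by
    rw [card_subtype, filter_true_of_mem (fun x hx => h hx)]
  have h1 := card_prefixed (A.subtype (· ∈ S))
  rw [hA, Fintype.card_coe] at h1
  have h2 : #(univ : Finset (Numbering ↑(Sᶜ))) = (Fintype.card α - #S).factorial := by
    rw [card_univ, Fintype.card_numbering, Fintype.card_coe, card_compl]
  refine le_of_le_of_eq ?_ (congrArg₂ (· * ·) h1 h2)
  refine le_of_le_of_eq ?_ (card_product _ _)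
  -- The `else` value is a dummy: every numbering considered has S as a prefix.
  refine card_le_card_of_injOn (fun f => if hf : f ∈ prefixed S then prefixedEquiv S ⟨f, hf⟩ else
    (Fintype.equivFin _, Fintype.equivFin _)) ?_ ?_
  · intro f hf
    simp only [coe_inter, Set.mem_inter_iff, mem_coe] at hf
    simp only [hf.2, dif_pos, coe_product, Set.mem_prod, mem_coe, mem_prefixed, mem_univ, and_true]
    intro x
    have := (mem_prefixed.1 hf.1) x
    rw [hA]
    simpa [prefixedEquiv] using this
  · intro f hf g hg hfg
    simp only [coe_inter, Set.mem_inter_iff, mem_coe] at hf hg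
    simpa [hf.2, hg.2] using hfg

/-- Turns conditional probabilities 1 / C(n, k) into 1 / n; the excluded values of k are why the
empty and the full set must be kept out of the families. -/
theorem le_choose_of_pos_of_lt {n k : ℕ} (h0 : 0 < k) (hk : k < n) : n ≤ n.choose k := by
  induction n generalizing k with
  | zero => omega
  | succ n ih =>
    obtain ⟨k, rfl⟩ : ∃ j, k = j + 1 := ⟨k - 1, by omega⟩
    rw [Nat.choose_succ_succ']
    rcases (by omega : k + 1 < n ∨ n = k + 1) with h | rfl
    · have := ih (by omega) h
      have := Nat.choose_pos (n := n) (k := k) (by omega)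
      omega
    · simp

theorem chainProb_pair_le {A S : Finset α} (h : A ⊆ S) :
    chainProb (fun f => f.IsPrefix A ∧ f.IsPrefix S) ≤
      ((Fintype.card α).choose #S : ℝ)⁻¹ * ((#S).choose #A : ℝ)⁻¹ := by
  rw [chainProb_eq_card_div (prefixed A ∩ prefixed S) (fun f => by simp),
    Nat.cast_choose ℝ S.card_le_univ, Nat.cast_choose ℝ (card_le_card h), inv_div, inv_div,
    div_mul_div_comm, div_le_div_iff₀ (by positivity) (by positivity)]
  have := card_prefixed_inter_prefixed_le h
  have h2 : (#(prefixed A ∩ prefixed S) : ℝ) ≤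
      (#A).factorial * (#S - #A).factorial * (Fintype.card α - #S).factorial := by
    exact_mod_cast this
  calc _ ≤ ((#A).factorial * (#S - #A).factorial * (Fintype.card α - #S).factorial : ℝ) *
      ((Fintype.card α).factorial * (#S).factorial) := by gcongr
    _ = _ := by ring

/-- The conditional probability of meeting a given smaller set. -/
theorem chainProb_pair_le_below {A S : Finset α} (h : A ⊂ S) (hA : A.Nonempty) :
    chainProb (fun f => f.IsPrefix A ∧ f.IsPrefix S) ≤
      ((Fintype.card α).choose #S : ℝ)⁻¹ * (#S : ℝ)⁻¹ := by
  refine (chainProb_pair_le h.subset).trans ?_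
  have hS : 0 < #S := card_pos.2 (hA.mono h.subset)
  have := le_choose_of_pos_of_lt (card_pos.2 hA) (card_lt_card h)
  gcongr

/-- The conditional probability of meeting a given larger set. -/
theorem chainProb_pair_le_above {S B : Finset α} (h : S ⊂ B) (hB : B ≠ univ) :
    chainProb (fun f => f.IsPrefix S ∧ f.IsPrefix B) ≤
      ((Fintype.card α).choose #S : ℝ)⁻¹ * ((Fintype.card α - #S : ℕ) : ℝ)⁻¹ := by
  refine (chainProb_pair_le h.subset).trans ?_
  have h1 := card_lt_card h
  have h2 : #B < Fintype.card α := by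
    rw [← card_univ]; exact card_lt_card (ssubset_univ_iff.2 hB)
  have key := Nat.choose_mul (n := Fintype.card α) (k := #B) (s := #S) h1.le
  rw [← mul_inv, ← mul_inv, ← Nat.cast_mul, ← Nat.cast_mul, key]
  have h3 := le_choose_of_pos_of_lt (n := Fintype.card α - #S) (k := #B - #S) (by omega) (by omega)
  have h4 := Nat.choose_pos (n := Fintype.card α) (k := #S) (by omega)
  have h5 : 0 < Fintype.card α - #S := by omega
  have : 0 < (Fintype.card α).choose #S * (Fintype.card α - #S) := Nat.mul_pos h4 h5
  gcongr

open Classical in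
/-- Linearity of expectation along a random full chain. -/
theorem sum_card_div_factorial {ι : Type*} (s : Finset ι) (p : ι → Numbering α → Prop) :
    (∑ f : Numbering α, (#{i ∈ s | p i f} : ℝ)) / (Fintype.card α).factorial =
      ∑ i ∈ s, chainProb (p i) := by
  unfold chainProb
  rw [← sum_div]
  congr 1
  simp only [card_filter, Nat.cast_sum]
  rw [sum_comm]

theorem chainProb_true_eq_one :
    (∑ _f : Numbering α, (1 : ℝ)) / (Fintype.card α).factorial = 1 := by
  simp only [sum_const, card_univ, Fintype.card_numbering, nsmul_eq_mul, mul_one]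
  exact div_self (by positivity)

omit [DecidableEq α] in
theorem Numbering.IsPrefix.ssubset_of_card_lt {f : Numbering α} {s t : Finset α}
    (hs : f.IsPrefix s) (ht : f.IsPrefix t) (h : #s < #t) : s ⊂ t :=
  (hs.subset_of_card_le_card ht h.le).ssubset_of_ne (by rintro rfl; omega)

omit [DecidableEq α] in
theorem Numbering.IsPrefix.eq_of_card_eq {f : Numbering α} {s t : Finset α}
    (hs : f.IsPrefix s) (ht : f.IsPrefix t) (h : #s = #t) : s = t :=
  (hs.subset_of_card_le_card ht h.le).antisymm (ht.subset_of_card_le_card hs h.ge)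

theorem Numbering.IsPrefix.exists_erase {f : Numbering α} {s : Finset α}
    (hs : f.IsPrefix s) (h : s.Nonempty) : ∃ x ∈ s, f.IsPrefix (s.erase x) := by
  have hpos := card_pos.2 h
  have hle := s.card_le_univ
  -- Positions start at 0, so this is the last element of the prefix.
  refine ⟨f.symm ⟨#s - 1, by omega⟩, ?_, ?_⟩
  · rw [hs]; simp; omega
  · have hmem : f.symm ⟨#s - 1, by omega⟩ ∈ s := by rw [hs]; simp; omega
    intro y
    rw [card_erase_of_mem hmem, mem_erase, hs y, Ne, Equiv.eq_symm_apply, Fin.ext_iff]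
    simp only
    omega

open Classical in
/-- On a chain, all but one member of a family lie above another member. -/
theorem card_filter_isPrefix_le_below (f : Numbering α) (F : Finset (Finset α)) :
    #{S ∈ F | f.IsPrefix S} ≤
      1 + #{S ∈ F | ∃ A ∈ {A ∈ F | A ⊂ S}, f.IsPrefix A ∧ f.IsPrefix S} := by
  rw [← card_filter_add_card_filter_not (s := {S ∈ F | f.IsPrefix S})
    (p := fun S => ∃ A ∈ F, A ⊂ S ∧ f.IsPrefix A), add_comm]
  gcongr
  · rw [card_le_one]
    intro S hS T hT
    simp only [mem_filter, not_exists, not_and] at hS hT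
    rcases lt_trichotomy #S #T with h | h | h
    · exact absurd hS.1.2 (hT.2 S hS.1.1 (hS.1.2.ssubset_of_card_lt hT.1.2 h))
    · exact hS.1.2.eq_of_card_eq hT.1.2 h
    · exact absurd hT.1.2 (hS.2 T hT.1.1 (hT.1.2.ssubset_of_card_lt hS.1.2 h))
  · intro S hS
    simp only [mem_filter] at hS ⊢
    obtain ⟨⟨h1, h2⟩, A, h3, h4, h5⟩ := hS
    exact ⟨h1, A, ⟨h3, h4⟩, h5, h2⟩

open Classical in
/-- On a chain, all but one member of a family lie below another member. -/
theorem card_filter_isPrefix_le_above (f : Numbering α) (F : Finset (Finset α)) :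
    #{S ∈ F | f.IsPrefix S} ≤
      1 + #{S ∈ F | ∃ B ∈ {B ∈ F | S ⊂ B}, f.IsPrefix S ∧ f.IsPrefix B} := by
  rw [← card_filter_add_card_filter_not (s := {S ∈ F | f.IsPrefix S})
    (p := fun S => ∃ A ∈ F, S ⊂ A ∧ f.IsPrefix A), add_comm]
  gcongr
  · rw [card_le_one]
    intro S hS T hT
    simp only [mem_filter, not_exists, not_and] at hS hT
    rcases lt_trichotomy #S #T with h | h | h
    · exact absurd hT.1.2 (hS.2 T hT.1.1 (hS.1.2.ssubset_of_card_lt hT.1.2 h))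
    · exact hS.1.2.eq_of_card_eq hT.1.2 h
    · exact absurd hS.1.2 (hT.2 S hS.1.1 (hT.1.2.ssubset_of_card_lt hS.1.2 h))
  · intro S hS
    simp only [mem_filter] at hS ⊢
    obtain ⟨⟨h1, h2⟩, A, h3, h4, h5⟩ := hS
    exact ⟨h1, A, ⟨h3, h4⟩, h2, h5⟩

open Classical in
/-- On a chain, all but one member of a family either directly succeed another member, or are
separated from the preceding member by a set strictly between members. -/
theorem card_filter_isPrefix_le_consecutive (f : Numbering α) (F M : Finset (Finset α))
    (hM : ∀ A ∈ F, ∀ B ∈ F, ∀ S, A ⊂ S → S ⊂ B → S ∈ M) :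
    #{S ∈ F | f.IsPrefix S} ≤
      1 + #{S ∈ F | ∃ x ∈ ({x ∈ S | S.erase x ∈ F} : Finset α),
          f.IsPrefix (S.erase x) ∧ f.IsPrefix S} +
        #{S ∈ M | (∃ A ∈ {A ∈ F | A ⊂ S}, f.IsPrefix A ∧ f.IsPrefix S) ∧
          ∃ B ∈ {B ∈ F | S ⊂ B}, f.IsPrefix S ∧ f.IsPrefix B} := by
  refine (card_filter_isPrefix_le_below f F).trans ?_
  rw [add_assoc]
  gcongr 1 + ?_
  rw [← card_filter_add_card_filter_not
    (s := {S ∈ F | ∃ A ∈ {A ∈ F | A ⊂ S}, f.IsPrefix A ∧ f.IsPrefix S})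
    (p := fun S => ∃ x ∈ ({x ∈ S | S.erase x ∈ F} : Finset α),
      f.IsPrefix (S.erase x) ∧ f.IsPrefix S)]
  gcongr ?_ + ?_
  · refine card_le_card fun S hS => ?_
    simp only [mem_filter] at hS ⊢
    exact ⟨hS.1.1, hS.2⟩
  -- T is the predecessor of S on the chain; ∅ is a dummy value elsewhere.
  · have key : ∀ S : Finset α, ∃ T, (f.IsPrefix S → S.Nonempty →
        ∃ x ∈ S, T = S.erase x ∧ f.IsPrefix T) := by
      intro S
      by_cases h : f.IsPrefix S ∧ S.Nonempty
      · obtain ⟨x, hx, hx'⟩ := h.1.exists_erase h.2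
        exact ⟨_, fun _ _ => ⟨x, hx, rfl, hx'⟩⟩
      · exact ⟨∅, fun h1 h2 => absurd ⟨h1, h2⟩ h⟩
    choose T hT using key
    refine card_le_card_of_injOn T ?_ ?_
    · intro S hS
      simp only [coe_filter, mem_filter, Set.mem_ofPred_eq] at hS ⊢
      obtain ⟨⟨hSF, A, ⟨hAF, hAS⟩, hA, hSp⟩, hno⟩ := hS
      obtain ⟨x, hx, hTe, hTp⟩ := hT S hSp (card_pos.1 (by have := card_lt_card hAS; omega))
      have hTF : T S ∉ F := fun h => hno ⟨x, ⟨hx, hTe ▸ h⟩, hTe ▸ hTp, hSp⟩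
      have hTS : T S ⊂ S := hTe ▸ erase_ssubset hx
      have hAT : A ⊂ T S := by
        have h1 := card_lt_card hAS
        have h2 : #(T S) = #S - 1 := by rw [hTe, card_erase_of_mem hx]
        refine (hA.subset_of_card_le_card hTp (by omega)).ssubset_of_ne ?_
        rintro rfl; exact hTF hAF
      exact ⟨hM A hAF S hSF _ hAT hTS, ⟨A, ⟨hAF, hAT⟩, hA, hTp⟩, S, ⟨hSF, hTS⟩, hTp, hSp⟩
    · intro S hS S' hS' h
      simp only [coe_filter, mem_filter, Set.mem_ofPred_eq] at hS hS'
      obtain ⟨⟨hSF, A, ⟨hAF, hAS⟩, hA, hSp⟩, hno⟩ := hS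
      obtain ⟨⟨hSF', A', ⟨hAF', hAS'⟩, hA', hSp'⟩, hno'⟩ := hS'
      obtain ⟨x, hx, hTe, hTp⟩ := hT S hSp (card_pos.1 (by have := card_lt_card hAS; omega))
      obtain ⟨x', hx', hTe', hTp'⟩ := hT S' hSp' (card_pos.1 (by have := card_lt_card hAS'; omega))
      refine hSp.eq_of_card_eq hSp' ?_
      have h1 := card_erase_add_one hx
      have h2 := card_erase_add_one hx'
      rw [← hTe] at h1; rw [← hTe'] at h2
      rw [h] at h1; omega

theorem lubell_eq_sum_chainProb (F : Finset (Finset α)) :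
    lubell F = ∑ S ∈ F, chainProb (fun f => f.IsPrefix S) := by
  simp_rw [chainProb_isPrefix, lubell]

theorem lubell_le_below (F : Finset (Finset α)) :
    lubell F ≤ 1 + ∑ S ∈ F,
      chainProb (fun f => ∃ A ∈ {A ∈ F | A ⊂ S}, f.IsPrefix A ∧ f.IsPrefix S) := by
  classical
  rw [lubell_eq_sum_chainProb, ← sum_card_div_factorial, ← sum_card_div_factorial,
    ← chainProb_true_eq_one (α := α), ← add_div, ← sum_add_distrib]
  gcongr with f
  convert (Nat.cast_le (α := ℝ)).2 (card_filter_isPrefix_le_below f F) using 1 <;>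
    push_cast <;> congr!

theorem lubell_le_above (F : Finset (Finset α)) :
    lubell F ≤ 1 + ∑ S ∈ F,
      chainProb (fun f => ∃ B ∈ {B ∈ F | S ⊂ B}, f.IsPrefix S ∧ f.IsPrefix B) := by
  classical
  rw [lubell_eq_sum_chainProb, ← sum_card_div_factorial, ← sum_card_div_factorial,
    ← chainProb_true_eq_one (α := α), ← add_div, ← sum_add_distrib]
  gcongr with f
  convert (Nat.cast_le (α := ℝ)).2 (card_filter_isPrefix_le_above f F) using 1 <;>
    push_cast <;> congr!

theorem lubell_le_consecutive (F M : Finset (Finset α))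
    (hM : ∀ A ∈ F, ∀ B ∈ F, ∀ S, A ⊂ S → S ⊂ B → S ∈ M) :
    lubell F ≤ 1 + ∑ S ∈ F, chainProb (fun f =>
        ∃ x ∈ ({x ∈ S | S.erase x ∈ F} : Finset α), f.IsPrefix (S.erase x) ∧ f.IsPrefix S) +
      ∑ S ∈ M, chainProb (fun f => (∃ A ∈ {A ∈ F | A ⊂ S}, f.IsPrefix A ∧ f.IsPrefix S) ∧
          ∃ B ∈ {B ∈ F | S ⊂ B}, f.IsPrefix S ∧ f.IsPrefix B) := by
  classical
  rw [lubell_eq_sum_chainProb, ← sum_card_div_factorial, ← sum_card_div_factorial,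
    ← sum_card_div_factorial, ← chainProb_true_eq_one (α := α), ← add_div, ← add_div,
    ← sum_add_distrib, ← sum_add_distrib]
  gcongr with f
  convert (Nat.cast_le (α := ℝ)).2 (card_filter_isPrefix_le_consecutive f F M hM) using 1 <;>
    push_cast <;> congr!

end Chains

/-! ### Erdős–Stone for extremal numbers. -/

namespace SimpleGraph

/-- The minimum degree form of the Erdős–Stone theorem, for an arbitrary colorable graph. -/
theorem eventually_isContained_of_minDegree_of_colorable {V : Type*} [Finite V]
    {G : SimpleGraph V} {r : ℕ} (hG : G.Colorable (r + 1)) {ε : ℝ} (hε : 0 < ε) :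
    ∀ᶠ n in atTop, ∀ {H : SimpleGraph (Fin n)} [DecidableRel H.Adj],
      H.minDegree ≥ (1 - 1 / r + ε) * n → G ⊑ H := by
  classical
  have := Fintype.ofFinite V
  obtain ⟨C⟩ := hG
  filter_upwards [eventually_completeEquipartiteGraph_isContained_of_minDegree hε r
    (Fintype.card V)] with n hn H _ hH
  exact (isContained_completeEquipartiteGraph_of_colorable C _
    (fun c => Fintype.card_subtype_le _)).trans (hn hH)

/-- Delete a vertex of minimum degree: in a G-free graph that degree is below x. -/
theorem extremalNumber_succ_le {V : Type*} {G : SimpleGraph V} {n : ℕ} {x : ℝ}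
    (hx : 0 ≤ x)
    (h : ∀ {H : SimpleGraph (Fin (n + 1))} [DecidableRel H.Adj], x ≤ H.minDegree → G ⊑ H) :
    (extremalNumber (n + 1) G : ℝ) ≤ extremalNumber n G + x := by
  classical
  have := extremalNumber_le_iff_of_nonneg (V := Fin (n + 1)) G
    (m := (extremalNumber n G : ℝ) + x) (by positivity)
  rw [Fintype.card_fin] at this
  rw [this]
  intro H _ hfree
  have hdeg : (H.minDegree : ℝ) < x := by
    by_contra! hcon
    exact hfree (h hcon)
  obtain ⟨v, hv⟩ := H.exists_minimal_degree_vertex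
  have h1 := card_edgeFinset_deleteIncidenceSet_le_extremalNumber hfree v
  rw [card_edgeFinset_deleteIncidenceSet, Fintype.card_fin, Nat.add_sub_cancel] at h1
  have h2 : #H.edgeFinset ≤ extremalNumber n G + H.minDegree := by omega
  have h3 : (#H.edgeFinset : ℝ) ≤ extremalNumber n G + H.minDegree := by exact_mod_cast h2
  linarith

/-- The Erdős–Stone theorem with an explicit linear error term. -/
theorem exists_two_mul_extremalNumber_le {V : Type*} [Finite V]
    {G : SimpleGraph V} {r : ℕ} (hr : 1 ≤ r) (hG : G.Colorable (r + 1)) {ε : ℝ} (hε : 0 < ε) :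
    ∃ C : ℝ, 0 ≤ C ∧ ∀ n : ℕ,
      2 * (extremalNumber n G : ℝ) ≤ (1 - 1 / r + ε) * n ^ 2 + C * n := by
  obtain ⟨N, hN⟩ := eventually_atTop.1 (eventually_isContained_of_minDegree_of_colorable hG hε)
  set a : ℝ := 1 - 1 / r + ε with ha
  have ha0 : 0 ≤ a := by
    have : (1 : ℝ) / r ≤ 1 := by
      rw [div_le_one (by positivity)]
      exact_mod_cast hr
    linarith
  have hzero : extremalNumber 0 G = 0 := by
    have := (extremalNumber_le_iff (V := Fin 0) G 0).2 (fun H _ _ => by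
      simp [Subsingleton.elim H ⊥])
    simpa using this
  have hsmall : ∃ K : ℝ, 0 ≤ K ∧ ∀ n ≤ N, 2 * (extremalNumber n G : ℝ) ≤ K := by
    refine ⟨∑ i ∈ range (N + 1), 2 * (extremalNumber i G : ℝ), by positivity, fun n hn => ?_⟩
    exact single_le_sum (f := fun i => 2 * (extremalNumber i G : ℝ)) (fun i _ => by positivity)
      (mem_range.2 (by omega))
  obtain ⟨K, hK0, hK⟩ := hsmall
  -- K absorbs all n ≤ N; beyond that each step adds 2a(n + 1), exactly the increment of a(n² + n).
  have main : ∀ n : ℕ, 2 * (extremalNumber n G : ℝ) ≤ K + a * (n ^ 2 + n) := by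
    intro n
    induction n with
    | zero => simpa [hzero] using hK0
    | succ n ih =>
      rcases Nat.lt_or_ge N (n + 1) with h | h
      · have := extremalNumber_succ_le (G := G) (n := n) (x := a * (n + 1 : ℕ)) (by positivity)
          (fun {H} _ hH => hN (n + 1) h.le hH)
        push_cast at this ⊢
        nlinarith
      · have := hK _ h
        have : 0 ≤ a * (((n + 1 : ℕ) : ℝ) ^ 2 + (n + 1 : ℕ)) := by positivity
        linarith [hK _ h]
  refine ⟨K + a, by positivity, fun n => ?_⟩
  rcases Nat.eq_zero_or_pos n with rfl | hn
  · simp [hzero]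
  · have h1 : (1 : ℝ) ≤ n := by exact_mod_cast hn
    have := main n
    nlinarith

/-- Ordered adjacent pairs in a graph avoiding `G`. -/
theorem card_adj_pairs_le_of_free {V W : Type*} {G : SimpleGraph V} {a C : ℝ}
    (hC : ∀ n : ℕ, 2 * (extremalNumber n G : ℝ) ≤ a * n ^ 2 + C * n)
    [Fintype W] (H : SimpleGraph W) [DecidableRel H.Adj] (hH : G.Free H) :
    (#{p : W × W | H.Adj p.1 p.2} : ℝ) ≤ a * (Fintype.card W : ℝ) ^ 2 + C * Fintype.card W := by
  classical
  refine le_trans ?_ (hC (Fintype.card W))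
  have h1 := card_edgeFinset_le_extremalNumber hH
  have h2 : #{p : W × W | H.Adj p.1 p.2} = 2 * #H.edgeFinset := by
    rw [← sum_degrees_eq_twice_card_edges, card_filter, Fintype.sum_prod_type]
    refine sum_congr rfl fun v _ => ?_
    rw [← card_filter, ← card_neighborFinset_eq_degree]
    congr 1
    ext w
    simp
  rw [h2]
  push_cast
  have : (#H.edgeFinset : ℝ) ≤ extremalNumber (Fintype.card W) G := by exact_mod_cast h1
  linarith

end SimpleGraph

/-! ### Sets far from the middle layer. -/

section Tail

theorem sum_exp_two_mul_card_sub (n : ℕ) (u : ℝ) :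
    ∑ S : Finset (Fin n), Real.exp (u * (2 * #S - n)) = (2 * Real.cosh u) ^ n := by
  have := Fintype.sum_pow_mul_eq_add_pow (Fin n) (Real.exp u) (Real.exp (-u))
  rw [Fintype.card_fin] at this
  rw [Real.cosh_eq, mul_div_cancel₀ _ two_ne_zero, ← this]
  refine sum_congr rfl fun S _ => ?_
  have hS : #S ≤ n := by simpa using S.card_le_univ
  rw [← Real.exp_nat_mul, ← Real.exp_nat_mul, ← Real.exp_add, Nat.cast_sub hS]
  congr 1
  ring

/-- Chernoff's bound for the number of sets whose size is far from the middle. -/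
theorem card_far_from_middle_le (n : ℕ) {δ : ℝ} (hδ : 0 ≤ δ) :
    (#{S : Finset (Fin n) | δ * n < |2 * (#S : ℝ) - n|} : ℝ) ≤
      2 * 2 ^ n * Real.exp (-(δ ^ 2 / 2) * n) := by
  have hcosh : (2 * Real.cosh δ) ^ n ≤ 2 ^ n * Real.exp (δ ^ 2 / 2 * n) := by
    rw [mul_pow, mul_comm (δ ^ 2 / 2) (n : ℝ), Real.exp_nat_mul]
    gcongr
    exact Real.cosh_le_exp_half_sq δ
  -- Exponential Markov inequality with parameters δ and -δ, one for each tail.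
  have h1 : (#{S : Finset (Fin n) | δ * n < |2 * (#S : ℝ) - n|} : ℝ) * Real.exp (δ ^ 2 * n) ≤
      2 * (2 * Real.cosh δ) ^ n := by
    calc _ = ∑ S : Finset (Fin n) with δ * n < |2 * (#S : ℝ) - n|, Real.exp (δ ^ 2 * n) := by
          rw [sum_const, nsmul_eq_mul]
      _ ≤ ∑ S : Finset (Fin n) with δ * n < |2 * (#S : ℝ) - n|,
          (Real.exp (δ * (2 * #S - n)) + Real.exp (-δ * (2 * #S - n))) := by
          refine sum_le_sum fun S hS => ?_
          have hS' := (mem_filter.1 hS).2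
          rcases le_total 0 (2 * (#S : ℝ) - n) with h | h
          · rw [abs_of_nonneg h] at hS'
            have : Real.exp (δ ^ 2 * n) ≤ Real.exp (δ * (2 * #S - n)) :=
              Real.exp_le_exp.2 (by nlinarith)
            linarith [Real.exp_pos (-δ * (2 * #S - n))]
          · rw [abs_of_nonpos h] at hS'
            have : Real.exp (δ ^ 2 * n) ≤ Real.exp (-δ * (2 * #S - n)) :=
              Real.exp_le_exp.2 (by nlinarith)
            linarith [Real.exp_pos (δ * (2 * #S - n))]
      _ ≤ ∑ S : Finset (Fin n),
          (Real.exp (δ * (2 * #S - n)) + Real.exp (-δ * (2 * #S - n))) :=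
          sum_le_sum_of_subset_of_nonneg (filter_subset _ _) fun _ _ _ => by positivity
      _ = _ := by
          rw [sum_add_distrib, sum_exp_two_mul_card_sub, sum_exp_two_mul_card_sub, Real.cosh_neg]
          ring
  have h2 : Real.exp (-(δ ^ 2 / 2) * n) = Real.exp (δ ^ 2 / 2 * n) / Real.exp (δ ^ 2 * n) := by
    rw [← Real.exp_sub]
    congr 1
    ring
  rw [h2, mul_div_assoc', le_div_iff₀ (Real.exp_pos _)]
  linarith

theorem two_pow_le_succ_mul_choose_middle (n : ℕ) :
    (2 : ℝ) ^ n ≤ (n + 1) * n.choose (n / 2) := by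
  have h : 2 ^ n ≤ (n + 1) * n.choose (n / 2) := by
    rw [← Nat.sum_range_choose]
    exact (sum_le_card_nsmul _ _ _ fun i _ => Nat.choose_le_middle i n).trans (by simp)
  exact_mod_cast h

theorem eventually_card_far_from_middle_le {δ η : ℝ} (hδ : 0 < δ) (hη : 0 < η) :
    ∀ᶠ n : ℕ in atTop, (#{S : Finset (Fin n) | δ * n < |2 * (#S : ℝ) - n|} : ℝ) ≤
      η * n.choose (n / 2) := by
  have h1 : Tendsto (fun n : ℕ => 2 * (((n : ℝ) + 1) * Real.exp (-(δ ^ 2 / 2) * n)))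
      atTop (𝓝 0) := by
    have hc : 0 < δ ^ 2 / 2 := by positivity
    have e1 := ((tendsto_rpow_mul_exp_neg_mul_atTop_nhds_zero 1 _ hc).comp
      tendsto_natCast_atTop_atTop)
    have e0 := ((tendsto_rpow_mul_exp_neg_mul_atTop_nhds_zero 0 _ hc).comp
      tendsto_natCast_atTop_atTop)
    have := (e1.add e0).const_mul 2
    simp only [add_zero, mul_zero] at this
    refine this.congr fun n => ?_
    simp [add_mul]
  filter_upwards [h1.eventually_lt_const hη] with n hn
  refine (card_far_from_middle_le n hδ.le).trans ?_
  have h2 := two_pow_le_succ_mul_choose_middle n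
  calc 2 * 2 ^ n * Real.exp (-(δ ^ 2 / 2) * n)
      ≤ 2 * ((n + 1) * n.choose (n / 2)) * Real.exp (-(δ ^ 2 / 2) * n) := by gcongr
    _ = 2 * ((n + 1) * Real.exp (-(δ ^ 2 / 2) * n)) * n.choose (n / 2) := by ring
    _ ≤ _ := by gcongr

end Tail

/-! ### Lubell weights of families with few comparabilities. -/

section Families

variable {α : Type*} [Fintype α] [DecidableEq α]

omit [DecidableEq α] in
theorem lubell_nonneg (F : Finset (Finset α)) : 0 ≤ lubell F :=
  sum_nonneg fun _ _ => by positivity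

omit [DecidableEq α] in
theorem card_le_choose_mul_lubell (F : Finset (Finset α)) :
    (#F : ℝ) ≤ (Fintype.card α).choose (Fintype.card α / 2) * lubell F := by
  rw [lubell, mul_sum]
  calc (#F : ℝ) = ∑ _S ∈ F, (1 : ℝ) := by simp
    _ ≤ _ := sum_le_sum fun S _ => by
      have h0 : (0 : ℝ) < (Fintype.card α).choose #S := by
        exact_mod_cast Nat.choose_pos S.card_le_univ
      rw [← div_eq_mul_inv, one_le_div h0]
      exact_mod_cast Nat.choose_le_middle _ _

theorem chainProb_exists_below_le {F : Finset (Finset α)} {S : Finset α} {m s : ℕ} (hm : 1 ≤ m)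
    (hF : ∀ A ∈ F, A.Nonempty) (hS : m ≤ #S) (hs : #{A ∈ F | A ⊂ S} ≤ s) :
    chainProb (fun f => ∃ A ∈ {A ∈ F | A ⊂ S}, f.IsPrefix A ∧ f.IsPrefix S) ≤
      ((Fintype.card α).choose #S : ℝ)⁻¹ * (s / m) := by
  refine (chainProb_exists_le _ _).trans ?_
  calc _ ≤ ∑ A ∈ F with A ⊂ S, ((Fintype.card α).choose #S : ℝ)⁻¹ * (#S : ℝ)⁻¹ :=
        sum_le_sum fun A hA => chainProb_pair_le_below (mem_filter.1 hA).2
          (hF A (mem_filter.1 hA).1)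
    _ = ((Fintype.card α).choose #S : ℝ)⁻¹ * (#{A ∈ F | A ⊂ S} / #S) := by
        rw [sum_const, nsmul_eq_mul]; ring
    _ ≤ _ := by gcongr

theorem chainProb_exists_above_le {F : Finset (Finset α)} {S : Finset α} {m s : ℕ} (hm : 1 ≤ m)
    (hF : ∀ A ∈ F, A ≠ univ) (hS : #S + m ≤ Fintype.card α) (hs : #{B ∈ F | S ⊂ B} ≤ s) :
    chainProb (fun f => ∃ B ∈ {B ∈ F | S ⊂ B}, f.IsPrefix S ∧ f.IsPrefix B) ≤
      ((Fintype.card α).choose #S : ℝ)⁻¹ * (s / m) := by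
  refine (chainProb_exists_le _ _).trans ?_
  have hS' : m ≤ Fintype.card α - #S := by omega
  calc _ ≤ ∑ A ∈ F with S ⊂ A,
        ((Fintype.card α).choose #S : ℝ)⁻¹ * ((Fintype.card α - #S : ℕ) : ℝ)⁻¹ :=
        sum_le_sum fun A hA => chainProb_pair_le_above (mem_filter.1 hA).2
          (hF A (mem_filter.1 hA).1)
    _ = ((Fintype.card α).choose #S : ℝ)⁻¹ *
        (#{B ∈ F | S ⊂ B} / (Fintype.card α - #S : ℕ)) := by
        rw [sum_const, nsmul_eq_mul]; ring
    _ ≤ _ := by gcongr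

/-- All members of the family have at least `m` elements and miss at least `m` elements. -/
def IsCentral (m : ℕ) (F : Finset (Finset α)) : Prop :=
  ∀ S ∈ F, m ≤ #S ∧ #S + m ≤ Fintype.card α

omit [DecidableEq α] in
theorem IsCentral.mono {m : ℕ} {F G : Finset (Finset α)} (hG : IsCentral m G) (h : F ⊆ G) :
    IsCentral m F := fun S hS => hG S (h hS)

omit [DecidableEq α] in
theorem IsCentral.nonempty {m : ℕ} {F : Finset (Finset α)} (hF : IsCentral m F) (hm : 1 ≤ m)
    (S : Finset α) (hS : S ∈ F) : S.Nonempty :=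
  card_pos.1 (hm.trans (hF S hS).1)

omit [DecidableEq α] in
theorem IsCentral.ne_univ {m : ℕ} {F : Finset (Finset α)} (hF : IsCentral m F) (hm : 1 ≤ m)
    (S : Finset α) (hS : S ∈ F) : S ≠ univ := by
  rintro rfl
  have := (hF _ hS).2
  rw [card_univ] at this
  omega

/-- A family in which every member has few members below it is nearly an antichain. -/
theorem lubell_le_of_few_below {F : Finset (Finset α)} {m s : ℕ} (hm : 1 ≤ m)
    (hF : IsCentral m F) (hs : ∀ S ∈ F, #{A ∈ F | A ⊂ S} ≤ s) :
    lubell F ≤ 1 + lubell F * (s / m) := by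
  refine (lubell_le_below F).trans ?_
  rw [lubell, sum_mul]
  gcongr with S hS
  exact chainProb_exists_below_le hm (hF.nonempty hm) (hF S hS).1 (hs S hS)

/-- A family in which every member has few members above it is nearly an antichain. -/
theorem lubell_le_of_few_above {F : Finset (Finset α)} {m s : ℕ} (hm : 1 ≤ m)
    (hF : IsCentral m F) (hs : ∀ S ∈ F, #{B ∈ F | S ⊂ B} ≤ s) :
    lubell F ≤ 1 + lubell F * (s / m) := by
  refine (lubell_le_above F).trans ?_
  rw [lubell, sum_mul]
  gcongr with S hS
  exact chainProb_exists_above_le hm (hF.ne_univ hm) (hF S hS).2 (hs S hS)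

/-- In a family where every set has few members below or few members above, only pairs of
members on consecutive levels contribute to the excess of the Lubell weight over one. -/
theorem lubell_le_of_few_below_or_above {F M : Finset (Finset α)} {m s : ℕ} (hm : 1 ≤ m)
    (hF : IsCentral m F) (hM : IsCentral m M)
    (hFM : ∀ A ∈ F, ∀ B ∈ F, ∀ S, A ⊂ S → S ⊂ B → S ∈ M)
    (hs : ∀ S, #{A ∈ F | A ⊂ S} ≤ s ∨ #{B ∈ F | S ⊂ B} ≤ s) :
    lubell F ≤ 1 + ∑ B ∈ F, ((Fintype.card α).choose #B : ℝ)⁻¹ *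
        (#{x ∈ B | B.erase x ∈ F} / #B) + lubell M * (s / m) := by
  refine (lubell_le_consecutive F M hFM).trans ?_
  rw [lubell, sum_mul]
  gcongr with B hB S hS
  · refine (chainProb_exists_le _ _).trans ?_
    calc _ ≤ ∑ x ∈ B with B.erase x ∈ F, ((Fintype.card α).choose #B : ℝ)⁻¹ * (#B : ℝ)⁻¹ :=
          sum_le_sum fun x hx => chainProb_pair_le_below (erase_ssubset (mem_filter.1 hx).1)
            (hF.nonempty hm _ (mem_filter.1 hx).2)
      _ = _ := by rw [sum_const, nsmul_eq_mul]; ring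
  · rcases hs S with h | h
    · exact (chainProb_mono fun f hf => hf.1).trans
        (chainProb_exists_below_le hm (hF.nonempty hm) (hM S hS).1 h)
    · exact (chainProb_mono fun f hf => hf.2).trans
        (chainProb_exists_above_le hm (hF.ne_univ hm) (hM S hS).2 h)

/-- Exchange of summation between sets and the sets obtained by removing a point. -/
theorem sum_erase_comm (F G : Finset (Finset α)) (φ : Finset α → α → ℝ) :
    ∑ B ∈ F, ∑ x ∈ B with B.erase x ∈ G, φ B x =
      ∑ A ∈ G, ∑ x with x ∉ A ∧ insert x A ∈ F, φ (insert x A) x := by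
  rw [sum_sigma', sum_sigma']
  refine sum_bij' (fun p _ => ⟨p.1.erase p.2, p.2⟩) (fun p _ => ⟨insert p.2 p.1, p.2⟩)
    ?_ ?_ ?_ ?_ ?_
  · rintro ⟨B, x⟩ h
    simp only [mem_sigma, mem_filter, mem_univ, true_and] at h ⊢
    refine ⟨h.2.2, notMem_erase x B, ?_⟩
    rw [insert_erase h.2.1]; exact h.1
  · rintro ⟨A, x⟩ h
    simp only [mem_sigma, mem_filter, mem_univ, true_and] at h ⊢
    refine ⟨h.2.2, mem_insert_self x A, ?_⟩
    rw [erase_insert h.2.1]; exact h.1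
  · rintro ⟨B, x⟩ h
    simp only [mem_sigma, mem_filter] at h
    simp [insert_erase h.2.1]
  · rintro ⟨A, x⟩ h
    simp only [mem_sigma, mem_filter, mem_univ, true_and] at h
    simp [erase_insert h.2.1]
  · rintro ⟨B, x⟩ h
    simp only [mem_sigma, mem_filter] at h
    simp [insert_erase h.2.1]

/-- The probability that a chain contains two given consecutive sets, computed from the upper one or
from the lower one. This lets such pairs be charged to either end. -/
theorem inv_choose_succ_mul (n k : ℕ) :
    (n.choose (k + 1) : ℝ)⁻¹ * ((k + 1 : ℕ) : ℝ)⁻¹ =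
      (n.choose k : ℝ)⁻¹ * ((n - k : ℕ) : ℝ)⁻¹ := by
  rw [← mul_inv, ← mul_inv]
  congr 1
  exact_mod_cast Nat.choose_succ_right_eq n k

/-- The sum runs over upper ends, but the hypothesis concerns sets above; so each pair is recharged
to its lower end. -/
theorem sum_consecutive_le_of_few_above {F : Finset (Finset α)} {m s : ℕ} (hm : 1 ≤ m)
    (hF : IsCentral m F) (hs : ∀ S ∈ F, #{B ∈ F | S ⊂ B} ≤ s) :
    ∑ B ∈ F, ((Fintype.card α).choose #B : ℝ)⁻¹ * (#{x ∈ B | B.erase x ∈ F} / #B) ≤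
      lubell F * (s / m) := by
  have h1 : ∀ B ∈ F, ((Fintype.card α).choose #B : ℝ)⁻¹ * (#{x ∈ B | B.erase x ∈ F} / #B) =
      ∑ x ∈ B with B.erase x ∈ F, ((Fintype.card α).choose #B : ℝ)⁻¹ * (#B : ℝ)⁻¹ := by
    intro B _
    rw [sum_const, nsmul_eq_mul]; ring
  rw [sum_congr rfl h1, sum_erase_comm F F
    (fun B _ => ((Fintype.card α).choose #B : ℝ)⁻¹ * (#B : ℝ)⁻¹), lubell, sum_mul]
  refine sum_le_sum fun A hA => ?_
  have hA2 := (hF A hA).2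
  have hcard : #{x | x ∉ A ∧ insert x A ∈ F} ≤ s := by
    refine le_trans ?_ (hs A hA)
    refine card_le_card_of_injOn (fun x => insert x A) ?_ ?_
    · intro x hx
      have hx' := (mem_filter.1 hx).2
      exact mem_filter.2 ⟨hx'.2, ssubset_insert hx'.1⟩
    · intro x hx y hy hxy
      have hx' := (mem_filter.1 hx).2
      exact (insert_inj hx'.1).1 hxy
  have h2 : ∀ x ∈ ({x | x ∉ A ∧ insert x A ∈ F} : Finset α),
      ((Fintype.card α).choose #(insert x A) : ℝ)⁻¹ * (#(insert x A) : ℝ)⁻¹ =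
        ((Fintype.card α).choose #A : ℝ)⁻¹ * ((Fintype.card α - #A : ℕ) : ℝ)⁻¹ := by
    intro x hx
    rw [card_insert_of_notMem (mem_filter.1 hx).2.1]
    exact inv_choose_succ_mul _ _
  rw [sum_congr rfl h2, sum_const, nsmul_eq_mul]
  have h3 : m ≤ Fintype.card α - #A := by omega
  calc (#{x | x ∉ A ∧ insert x A ∈ F} : ℝ) *
        (((Fintype.card α).choose #A : ℝ)⁻¹ * ((Fintype.card α - #A : ℕ) : ℝ)⁻¹)
      = ((Fintype.card α).choose #A : ℝ)⁻¹ *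
        (#{x | x ∉ A ∧ insert x A ∈ F} / (Fintype.card α - #A : ℕ)) := by ring
    _ ≤ _ := by gcongr

omit [Fintype α] in
theorem card_filter_erase_mem_le (F : Finset (Finset α)) (B : Finset α) :
    #{x ∈ B | B.erase x ∈ F} ≤ #{A ∈ F | A ⊂ B} := by
  refine card_le_card_of_injOn (fun x => B.erase x) ?_ ?_
  · intro x hx
    have hx' := mem_filter.1 hx
    exact mem_filter.2 ⟨hx'.2, erase_ssubset hx'.1⟩
  · intro x hx y hy hxy
    exact erase_injOn B (mem_filter.1 hx).1 (mem_filter.1 hy).1 hxy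

/-- Consecutive pairs within a family are, up to a small error, pairs formed by a member with few
members below it and a member with few members above it. -/
theorem sum_consecutive_le {F A B : Finset (Finset α)} {m s : ℕ} (hm : 1 ≤ m)
    (hF : IsCentral m F) (hAB : Disjoint A B) (hFAB : F = A ∪ B)
    (hA : ∀ S ∈ A, #{T ∈ F | T ⊂ S} ≤ s) (hB : ∀ S ∈ B, #{T ∈ F | S ⊂ T} ≤ s) :
    ∑ S ∈ F, ((Fintype.card α).choose #S : ℝ)⁻¹ * (#{x ∈ S | S.erase x ∈ F} / #S) ≤
      ∑ S ∈ B, ((Fintype.card α).choose #S : ℝ)⁻¹ * (#{x ∈ S | S.erase x ∈ A} / #S) +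
        (lubell A + lubell B) * (s / m) := by
  have hBF : B ⊆ F := hFAB ▸ subset_union_right
  have hAF : A ⊆ F := hFAB ▸ subset_union_left
  have h1 : ∑ S ∈ A, ((Fintype.card α).choose #S : ℝ)⁻¹ * (#{x ∈ S | S.erase x ∈ F} / #S) ≤
      lubell A * (s / m) := by
    rw [lubell, sum_mul]
    refine sum_le_sum fun S hS => ?_
    have h2 := (card_filter_erase_mem_le F S).trans (hA S hS)
    have h3 := (hF S (hAF hS)).1
    gcongr
  have h2 := sum_consecutive_le_of_few_above hm (hF.mono hBF)
    (fun S hS => (card_le_card (filter_subset_filter _ hBF)).trans (hB S hS))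
  have h3 : ∑ S ∈ B, ((Fintype.card α).choose #S : ℝ)⁻¹ * (#{x ∈ S | S.erase x ∈ F} / #S) =
      ∑ S ∈ B, ((Fintype.card α).choose #S : ℝ)⁻¹ * (#{x ∈ S | S.erase x ∈ A} / #S) +
      ∑ S ∈ B, ((Fintype.card α).choose #S : ℝ)⁻¹ * (#{x ∈ S | S.erase x ∈ B} / #S) := by
    rw [← sum_add_distrib]
    refine sum_congr rfl fun S _ => ?_
    have : #{x ∈ S | S.erase x ∈ F} = #{x ∈ S | S.erase x ∈ A} + #{x ∈ S | S.erase x ∈ B} := by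
      rw [← card_union_of_disjoint, ← filter_or]
      · simp [hFAB]
      · rw [disjoint_filter]
        exact fun x _ h h' => disjoint_left.1 hAB h h'
    rw [this]
    push_cast
    ring
  have h4 : ∑ S ∈ F, ((Fintype.card α).choose #S : ℝ)⁻¹ * (#{x ∈ S | S.erase x ∈ F} / #S) =
      ∑ S ∈ A, ((Fintype.card α).choose #S : ℝ)⁻¹ * (#{x ∈ S | S.erase x ∈ F} / #S) +
      ∑ S ∈ B, ((Fintype.card α).choose #S : ℝ)⁻¹ * (#{x ∈ S | S.erase x ∈ F} / #S) := by
    rw [← sum_union hAB, ← hFAB]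
  rw [h4, h3]
  linarith

/-- Cauchy–Schwarz with the Lubell weights. -/
theorem sum_consecutive_sq_le (A B : Finset (Finset α)) :
    (∑ S ∈ B, ((Fintype.card α).choose #S : ℝ)⁻¹ * (#{x ∈ S | S.erase x ∈ A} / #S)) ^ 2 ≤
      lubell B * ∑ S ∈ B, ((Fintype.card α).choose #S : ℝ)⁻¹ *
        (#{x ∈ S | S.erase x ∈ A} / #S : ℝ) ^ 2 :=
  sum_sq_le_sum_mul_sum_of_sq_le_mul _ (fun _ _ => by positivity) (fun _ _ => by positivity)
    (fun _ _ => le_of_eq (by ring))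

end Families

/-! ### Second moments and link graphs. -/

section Link

variable {α : Type*} [Fintype α] [DecidableEq α]

/-- The elements that extend `D` to a member of `A`. -/
def extensions (A : Finset (Finset α)) (D : Finset α) : Finset α :=
  {x | x ∉ D ∧ insert x D ∈ A}

theorem mem_extensions {A : Finset (Finset α)} {D : Finset α} {x : α} :
    x ∈ extensions A D ↔ x ∉ D ∧ insert x D ∈ A := by
  simp [extensions]

/-- Pairs of elements of `S ∈ B` whose deletions lie in `A` correspond to edges of the link graphs
of the sets obtained by deleting both elements. -/
theorem sum_offDiag_erase (A B : Finset (Finset α)) (W : ℕ → ℝ) :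
    ∑ S ∈ B, ∑ _p ∈ ({x ∈ S | S.erase x ∈ A} : Finset α).offDiag, W #S =
      ∑ D : Finset α, ∑ _p ∈ (extensions A D).offDiag with
        insert _p.1 (insert _p.2 D) ∈ B, W (#D + 2) := by
  rw [sum_sigma', sum_sigma']
  refine sum_bij' (fun q _ => ⟨(q.1.erase q.2.1).erase q.2.2, q.2⟩)
    (fun q _ => ⟨insert q.2.1 (insert q.2.2 q.1), q.2⟩) ?_ ?_ ?_ ?_ ?_
  · rintro ⟨S, x, y⟩ h
    simp only [mem_sigma, mem_offDiag, mem_filter, mem_univ, true_and, mem_extensions] at h ⊢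
    obtain ⟨hS, ⟨hx, hxA⟩, ⟨hy, hyA⟩, hxy⟩ := h
    have e1 : insert y ((S.erase x).erase y) = S.erase x :=
      insert_erase (mem_erase.2 ⟨Ne.symm hxy, hy⟩)
    have e2 : insert x ((S.erase x).erase y) = S.erase y := by
      rw [erase_right_comm]
      exact insert_erase (mem_erase.2 ⟨hxy, hx⟩)
    rw [e1, e2, insert_erase hx]
    simp [hyA, hxA, hxy, hS]
  · rintro ⟨D, x, y⟩ h
    simp only [mem_sigma, mem_offDiag, mem_filter, mem_univ, true_and, mem_extensions] at h ⊢
    obtain ⟨⟨⟨hx, hxA⟩, ⟨hy, hyA⟩, hxy⟩, hB⟩ := h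
    have e1 : (insert x (insert y D)).erase x = insert y D :=
      erase_insert (by simp [hxy, hx])
    have e2 : (insert x (insert y D)).erase y = insert x D := by
      rw [insert_comm]
      exact erase_insert (by simp [Ne.symm hxy, hy])
    rw [e1, e2]
    simp [hB, hxA, hyA, hxy]
  · rintro ⟨S, x, y⟩ h
    simp only [mem_sigma, mem_offDiag, mem_filter] at h
    obtain ⟨hS, ⟨hx, hxA⟩, ⟨hy, hyA⟩, hxy⟩ := h
    simp only
    rw [insert_erase (mem_erase.2 ⟨Ne.symm hxy, hy⟩), insert_erase hx]
  · rintro ⟨D, x, y⟩ h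
    simp only [mem_sigma, mem_offDiag, mem_filter, mem_univ, true_and, mem_extensions] at h
    obtain ⟨⟨⟨hx, hxA⟩, ⟨hy, hyA⟩, hxy⟩, hB⟩ := h
    simp only
    rw [erase_insert (by simp [hxy, hx]), erase_insert hy]
  · rintro ⟨S, x, y⟩ h
    simp only [mem_sigma, mem_offDiag, mem_filter] at h
    obtain ⟨hS, ⟨hx, hxA⟩, ⟨hy, hyA⟩, hxy⟩ := h
    simp only
    have h1 := card_erase_add_one hx
    have h2 := card_erase_add_one (mem_erase.2 ⟨Ne.symm hxy, hy⟩)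
    congr 1
    omega

/-- Each S ∈ A arises as D ∪ {x} in |S| ways. After regrouping by S, its coefficient is its Lubell
weight times |S| / (|S| + 1) times 1 + 1 / (n - |S|), n being the size of the ground set. -/
theorem sum_card_extensions_le {A : Finset (Finset α)} {m : ℕ} (hm : 1 ≤ m)
    (hA : IsCentral m A) :
    ∑ D : Finset α, ((Fintype.card α).choose (#D + 2) : ℝ)⁻¹ * ((#D + 2 : ℕ) : ℝ)⁻¹ ^ 2 *
        (#(extensions A D) * ((Fintype.card α - #D : ℕ) : ℝ)) ≤
      lubell A * (1 + 1 / m) := by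
  have h1 : ∀ D : Finset α,
      ((Fintype.card α).choose (#D + 2) : ℝ)⁻¹ * ((#D + 2 : ℕ) : ℝ)⁻¹ ^ 2 *
        (#(extensions A D) * ((Fintype.card α - #D : ℕ) : ℝ)) =
      ∑ x with x ∉ D ∧ insert x D ∈ A, ((Fintype.card α).choose (#(insert x D) + 1) : ℝ)⁻¹ *
        ((#(insert x D) + 1 : ℕ) : ℝ)⁻¹ ^ 2 * ((Fintype.card α + 1 - #(insert x D) : ℕ) : ℝ) := by
    intro D
    have : ∀ x ∈ ({x | x ∉ D ∧ insert x D ∈ A} : Finset α),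
        ((Fintype.card α).choose (#(insert x D) + 1) : ℝ)⁻¹ *
        ((#(insert x D) + 1 : ℕ) : ℝ)⁻¹ ^ 2 * ((Fintype.card α + 1 - #(insert x D) : ℕ) : ℝ) =
        ((Fintype.card α).choose (#D + 2) : ℝ)⁻¹ * ((#D + 2 : ℕ) : ℝ)⁻¹ ^ 2 *
          ((Fintype.card α - #D : ℕ) : ℝ) := by
      intro x hx
      rw [card_insert_of_notMem (mem_filter.1 hx).2.1, Nat.add_sub_add_right]
    rw [sum_congr rfl this, sum_const, nsmul_eq_mul, extensions]
    ring
  rw [sum_congr rfl fun D _ => h1 D, ← sum_erase_comm A univ (fun S _ =>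
    ((Fintype.card α).choose (#S + 1) : ℝ)⁻¹ * ((#S + 1 : ℕ) : ℝ)⁻¹ ^ 2 *
      ((Fintype.card α + 1 - #S : ℕ) : ℝ)), lubell, sum_mul]
  refine sum_le_sum fun S hS => ?_
  obtain ⟨hS1, hS2⟩ := hA S hS
  simp only [mem_univ, filter_true, sum_const, nsmul_eq_mul]
  have h2 := inv_choose_succ_mul (Fintype.card α) #S
  have h3 : ((Fintype.card α + 1 - #S : ℕ) : ℝ) = ((Fintype.card α - #S : ℕ) : ℝ) + 1 := by
    rw [Nat.sub_add_comm (by omega)]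
    push_cast
    rfl
  have h4 : (m : ℝ) ≤ ((Fintype.card α - #S : ℕ) : ℝ) := by
    exact_mod_cast (by omega : m ≤ Fintype.card α - #S)
  have h5 : (1 : ℝ) ≤ m := by exact_mod_cast hm
  set d : ℝ := ((Fintype.card α - #S : ℕ) : ℝ)
  have hd : 0 < d := by linarith
  calc (#S : ℝ) * (((Fintype.card α).choose (#S + 1) : ℝ)⁻¹ * ((#S + 1 : ℕ) : ℝ)⁻¹ ^ 2 *
        ((Fintype.card α + 1 - #S : ℕ) : ℝ))
      = (((Fintype.card α).choose (#S + 1) : ℝ)⁻¹ * ((#S + 1 : ℕ) : ℝ)⁻¹) *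
          (#S / ((#S + 1 : ℕ) : ℝ)) * (d + 1) := by rw [h3]; ring
    _ = ((Fintype.card α).choose #S : ℝ)⁻¹ * ((#S / ((#S + 1 : ℕ) : ℝ)) * (1 + 1 / d)) := by
        rw [h2]
        field_simp
    _ ≤ ((Fintype.card α).choose #S : ℝ)⁻¹ * (1 * (1 + 1 / m)) := by
        gcongr
        rw [div_le_one (by positivity)]
        push_cast
        linarith
    _ = _ := by rw [one_mul]

/-- If the link graphs satisfy a density bound, so does the second moment of the proportion of
`A` directly below members of `B`. -/
theorem sum_sq_consecutive_le {A B : Finset (Finset α)} {m : ℕ} (hm : 1 ≤ m)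
    (hA : IsCentral m A) (hB : IsCentral m B) {a C : ℝ} (ha : 0 ≤ a) (hC : 0 ≤ C)
    (hlink : ∀ D, (#{p ∈ (extensions A D).offDiag | insert p.1 (insert p.2 D) ∈ B} : ℝ) ≤
      a * (#(extensions A D) : ℝ) ^ 2 + C * #(extensions A D)) :
    ∑ S ∈ B, ((Fintype.card α).choose #S : ℝ)⁻¹ * (#{x ∈ S | S.erase x ∈ A} / #S : ℝ) ^ 2 ≤
      (a + C / m) * (lubell A * (1 + 1 / m)) + lubell B / m := by
  have hm' : (1 : ℝ) ≤ m := by exact_mod_cast hm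
  have h1 : ∀ S ∈ B, ((Fintype.card α).choose #S : ℝ)⁻¹ *
      (#{x ∈ S | S.erase x ∈ A} / #S : ℝ) ^ 2 ≤
      ∑ _p ∈ ({x ∈ S | S.erase x ∈ A} : Finset α).offDiag,
        ((Fintype.card α).choose #S : ℝ)⁻¹ * (#S : ℝ)⁻¹ ^ 2 +
        ((Fintype.card α).choose #S : ℝ)⁻¹ / m := by
    intro S hS
    have hS1 : (m : ℝ) ≤ #S := by exact_mod_cast (hB S hS).1
    have hq : (#{x ∈ S | S.erase x ∈ A} : ℝ) ≤ #S := by exact_mod_cast card_filter_le _ _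
    rw [sum_const, nsmul_eq_mul, offDiag_card, Nat.cast_sub (Nat.le_mul_self _), Nat.cast_mul]
    set q : ℝ := ((#{x ∈ S | S.erase x ∈ A} : ℕ) : ℝ)
    set b : ℝ := ((#S : ℕ) : ℝ)
    have hb : 0 < b := by linarith
    -- The diagonal pairs x = y in q², negligible because q ≤ b and m ≤ b.
    have h2 : q / b ^ 2 ≤ 1 / m := by
      rw [div_le_div_iff₀ (by positivity) (by linarith)]
      nlinarith
    calc _ = (q * q - q) * (((Fintype.card α).choose #S : ℝ)⁻¹ * b⁻¹ ^ 2) +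
          ((Fintype.card α).choose #S : ℝ)⁻¹ * (q / b ^ 2) := by
          field_simp
          ring
      _ ≤ (q * q - q) * (((Fintype.card α).choose #S : ℝ)⁻¹ * b⁻¹ ^ 2) +
          ((Fintype.card α).choose #S : ℝ)⁻¹ * (1 / m) := by gcongr
      _ = _ := by ring
  refine (sum_le_sum h1).trans ?_
  rw [sum_add_distrib, ← sum_div, ← lubell]
  gcongr
  rw [sum_offDiag_erase A B (fun k => ((Fintype.card α).choose k : ℝ)⁻¹ * (k : ℝ)⁻¹ ^ 2)]
  refine le_trans ?_ (mul_le_mul_of_nonneg_left (sum_card_extensions_le hm hA)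
    (by positivity : 0 ≤ a + C / m))
  rw [mul_sum]
  refine sum_le_sum fun D _ => ?_
  rw [sum_const, nsmul_eq_mul]
  rcases (extensions A D).eq_empty_or_nonempty with h0 | ⟨x, hx⟩
  · simp [h0]
  · have hx' := mem_extensions.1 hx
    have h2 := (hA _ hx'.2).2
    rw [card_insert_of_notMem hx'.1] at h2
    have h3 : (m : ℝ) ≤ ((Fintype.card α - #D : ℕ) : ℝ) := by
      exact_mod_cast (by omega : m ≤ Fintype.card α - #D)
    have h4 : (#(extensions A D) : ℝ) ≤ ((Fintype.card α - #D : ℕ) : ℝ) := by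
      rw [← card_compl]
      exact_mod_cast card_le_card fun y hy => mem_compl.2 (mem_extensions.1 hy).1
    set d : ℝ := ((Fintype.card α - #D : ℕ) : ℝ)
    have h5 : (#{p ∈ (extensions A D).offDiag | insert p.1 (insert p.2 D) ∈ B} : ℝ) ≤
        (a + C / m) * (#(extensions A D) * d) := by
      refine (hlink D).trans ?_
      set N : ℝ := ((#(extensions A D) : ℕ) : ℝ)
      have hN : 0 ≤ N := by positivity
      -- Only one factor N is replaced by d: the remaining N makes the sum over D a count of members
      -- of A.
      have e1 : a * N ^ 2 ≤ a * (N * d) := by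
        rw [sq]; gcongr
      have e2 : C * N ≤ C / m * (N * d) := by
        rw [div_mul_eq_mul_div, le_div_iff₀ (by linarith), mul_assoc]
        gcongr
      linarith
    calc _ ≤ ((a + C / m) * (#(extensions A D) * d)) *
          (((Fintype.card α).choose (#D + 2) : ℝ)⁻¹ * ((#D + 2 : ℕ) : ℝ)⁻¹ ^ 2) := by gcongr
      _ = _ := by ring

/-- The bound on the Lubell weight obtained by combining the estimates for both parts. -/
theorem lubell_le_of_link {F A B M : Finset (Finset α)} {m s : ℕ} (hm : 1 ≤ m) (hsm : s < m)
    (hF : IsCentral m F) (hM : IsCentral m M)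
    (hFM : ∀ A ∈ F, ∀ B ∈ F, ∀ S, A ⊂ S → S ⊂ B → S ∈ M)
    (hs : ∀ S, #{A ∈ F | A ⊂ S} ≤ s ∨ #{B ∈ F | S ⊂ B} ≤ s)
    (hAB : Disjoint A B) (hFAB : F = A ∪ B)
    (hA : ∀ S ∈ A, #{T ∈ F | T ⊂ S} ≤ s) (hB : ∀ S ∈ B, #{T ∈ F | S ⊂ T} ≤ s)
    {a C : ℝ} (ha : 0 ≤ a) (hC : 0 ≤ C)
    (hlink : ∀ D, (#{p ∈ (extensions A D).offDiag | insert p.1 (insert p.2 D) ∈ B} : ℝ) ≤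
      a * (#(extensions A D) : ℝ) ^ 2 + C * #(extensions A D)) :
    lubell F ≤ 1 + √((1 - s / m : ℝ)⁻¹ * ((a + C / m) * ((1 - s / m : ℝ)⁻¹ * (1 + 1 / m)) +
      (1 - s / m : ℝ)⁻¹ / m)) + (2 * (1 - s / m : ℝ)⁻¹ + lubell M) * (s / m) := by
  have hBF : B ⊆ F := hFAB ▸ subset_union_right
  have hAF : A ⊆ F := hFAB ▸ subset_union_left
  have hm' : (0 : ℝ) < m := by exact_mod_cast hm
  have hpos : (0 : ℝ) < 1 - s / m := by
    rw [sub_pos, div_lt_one hm']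
    exact_mod_cast hsm
  have hLA : lubell A ≤ (1 - s / m : ℝ)⁻¹ := by
    rw [← one_div, le_div_iff₀ hpos]
    have := lubell_le_of_few_below hm (hF.mono hAF)
      (fun S hS => (card_le_card (filter_subset_filter _ hAF)).trans (hA S hS))
    linarith
  have hLB : lubell B ≤ (1 - s / m : ℝ)⁻¹ := by
    rw [← one_div, le_div_iff₀ hpos]
    have := lubell_le_of_few_above hm (hF.mono hBF)
      (fun S hS => (card_le_card (filter_subset_filter _ hBF)).trans (hB S hS))
    linarith
  have h1 := lubell_le_of_few_below_or_above hm hF hM hFM hs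
  have h2 := sum_consecutive_le hm hF hAB hFAB hA hB
  have h3 := sum_sq_consecutive_le hm (hF.mono hAF) (hF.mono hBF) ha hC hlink
  have h4 := sum_consecutive_sq_le A B
  have hA0 := lubell_nonneg A
  have hB0 := lubell_nonneg B
  have h5 : ∑ S ∈ B, ((Fintype.card α).choose #S : ℝ)⁻¹ * (#{x ∈ S | S.erase x ∈ A} / #S) ≤
      √((1 - s / m : ℝ)⁻¹ * ((a + C / m) * ((1 - s / m : ℝ)⁻¹ * (1 + 1 / m)) +
      (1 - s / m : ℝ)⁻¹ / m)) := by
    refine Real.le_sqrt_of_sq_le (h4.trans ?_)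
    refine (mul_le_mul_of_nonneg_left h3 hB0).trans ?_
    gcongr
  have h6 : (lubell A + lubell B) * (s / m : ℝ) ≤ 2 * (1 - s / m : ℝ)⁻¹ * (s / m) := by
    gcongr
    linarith
  linarith

end Link

/-! ### Consequences of P(G)-freeness, and the central levels. -/

section PosetFree

variable {V : Type*} {G : SimpleGraph V} {n : ℕ}

theorem GraphPoset.le_iff {x y : GraphPoset G} :
    x ≤ y ↔ x = y ∨ ∃ v e, x = vertex v ∧ y = edge e ∧ v ∈ (e : Sym2 V) := by
  constructor
  · rintro (_ | ⟨v, e, h⟩)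
    · exact .inl rfl
    · exact .inr ⟨v, e, rfl, rfl, h⟩
  · rintro (rfl | ⟨v, e, rfl, rfl, h⟩)
    · exact le_rfl
    · exact GraphPoset.Le.incident v e h

/-- A family contains `P(G)` as soon as it contains suitable images of vertices and edges. -/
theorem not_isPosetFree_of_maps {F : Finset (Finset (Fin n))} (a : V → Finset (Fin n))
    (b : G.edgeSet → Finset (Fin n)) (haF : ∀ v, a v ∈ F) (hbF : ∀ e, b e ∈ F)
    (ha : Function.Injective a) (hb : Function.Injective b) (hab : ∀ v e, a v ≠ b e)
    (hle : ∀ v (e : G.edgeSet), v ∈ (e : Sym2 V) → a v ⊆ b e) : ¬ IsPosetFree F (GraphPoset G) := by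
  refine not_not.2 ⟨fun x => match x with
    | .vertex v => ⟨a v, haF v⟩
    | .edge e => ⟨b e, hbF e⟩, ?_, ?_⟩
  · rintro (v | e) (w | e') h
    · rw [ha (Subtype.ext_iff.1 h)]
    · exact absurd (Subtype.ext_iff.1 h) (hab v e')
    · exact absurd (Subtype.ext_iff.1 h).symm (hab w e)
    · rw [hb (Subtype.ext_iff.1 h)]
  · intro x y hxy
    rcases GraphPoset.le_iff.1 hxy with rfl | ⟨v, e, rfl, rfl, h⟩
    · exact le_rfl
    · exact hle v e h

theorem IsPosetFree.mono {H : Type*} [PartialOrder H] {F F' : Finset (Finset (Fin n))}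
    (hF : IsPosetFree F H) (h : F' ⊆ F) : IsPosetFree F' H := by
  rintro ⟨f, hf, hle⟩
  refine hF ⟨fun x => ⟨(f x).1, h (f x).2⟩, fun x y hxy => hf (Subtype.ext ?_), hle⟩
  have := congrArg Subtype.val hxy
  exact this

theorem exists_injective_of_card_le {W β : Type*} [Finite W] (s : Finset β)
    (h : Nat.card W ≤ #s) : ∃ f : W → β, Function.Injective f ∧ ∀ w, f w ∈ s := by
  have := Fintype.ofFinite W
  obtain ⟨f⟩ := Function.Embedding.nonempty_of_card_le (α := W) (β := s)
    (by rwa [Fintype.card_coe, ← Nat.card_eq_fintype_card])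
  exact ⟨fun w => f w, fun x y h => f.injective (Subtype.ext h), fun w => (f w).2⟩

/-- In a `P(G)`-free family, each set has few members below it or few members above it. -/
theorem IsPosetFree.few_below_or_few_above [Finite V] {F : Finset (Finset (Fin n))}
    (hF : IsPosetFree F (GraphPoset G)) (S : Finset (Fin n)) :
    #{A ∈ F | A ⊂ S} ≤ Nat.card V + Nat.card G.edgeSet ∨
      #{B ∈ F | S ⊂ B} ≤ Nat.card V + Nat.card G.edgeSet := by
  by_contra! h
  obtain ⟨a, ha, haS⟩ := exists_injective_of_card_le (W := V) {A ∈ F | A ⊂ S} (by omega)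
  obtain ⟨b, hb, hbS⟩ := exists_injective_of_card_le (W := G.edgeSet) {B ∈ F | S ⊂ B} (by omega)
  -- Every vertex image lies below every edge image through S, so incidence plays no role.
  have hab : ∀ (v : V) (e : G.edgeSet), a v ⊂ b e := fun v e =>
    (mem_filter.1 (haS v)).2.trans (mem_filter.1 (hbS e)).2
  exact not_isPosetFree_of_maps a b (fun v => (mem_filter.1 (haS v)).1)
    (fun e => (mem_filter.1 (hbS e)).1) ha hb (fun v e => (hab v e).ne)
    (fun v e (_ : v ∈ (e : Sym2 V)) => (hab v e).subset) hF

/-- The graph on the extensions of `D` whose edges are the pairs extending `D` to a member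
of `B`. -/
def linkGraph (A B : Finset (Finset (Fin n))) (D : Finset (Fin n)) :
    SimpleGraph (extensions A D) where
  Adj x y := x ≠ y ∧ insert (x : Fin n) (insert (y : Fin n) D) ∈ B
  symm := ⟨fun x y h => ⟨h.1.symm, by rw [insert_comm]; exact h.2⟩⟩
  loopless := ⟨fun x h => h.1 rfl⟩

/-- Given a copy f of G, send v to D ∪ {f v} and the edge uv to D ∪ {f u, f v}; these are members of
A and B respectively. -/
theorem IsPosetFree.free_linkGraph {F A B : Finset (Finset (Fin n))}
    (hF : IsPosetFree F (GraphPoset G)) (hA : A ⊆ F) (hB : B ⊆ F) (D : Finset (Fin n)) :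
    G.Free (linkGraph A B D) := by
  classical
  rintro ⟨f⟩
  have hfD : ∀ v, (f v : Fin n) ∉ D := fun v => (mem_extensions.1 (f v).2).1
  have hinj : ∀ {u v}, (f u : Fin n) = f v → u = v := fun h => f.injective (Subtype.ext h)
  let b : G.edgeSet → Finset (Fin n) := fun e =>
    D ∪ Finset.univ.filter fun x => ∃ v ∈ (e : Sym2 V), (f v : Fin n) = x
  have hmem : ∀ v (e : G.edgeSet), (f v : Fin n) ∈ b e ↔ v ∈ (e : Sym2 V) := by
    intro v e
    simp only [b, mem_union, hfD, mem_filter, mem_univ, true_and, false_or]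
    exact ⟨fun ⟨w, hw, h⟩ => hinj h ▸ hw, fun h => ⟨v, h, rfl⟩⟩
  refine not_isPosetFree_of_maps (G := G) (F := F) (fun v => insert (f v : Fin n) D) b
    (fun v => hA (mem_extensions.1 (f v).2).2) ?_ ?_ ?_ ?_ ?_ hF
  · rintro ⟨e, he⟩
    induction e with
    | _ u v =>
      have hadj : (linkGraph A B D).Adj (f u) (f v) := f.toHom.map_adj he
      have : b ⟨s(u, v), he⟩ = insert (f u : Fin n) (insert (f v : Fin n) D) := by
        ext x
        simp only [b, mem_union, mem_filter, mem_univ, true_and, Sym2.mem_iff, mem_insert,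
          exists_eq_or_imp, exists_eq_left]
        grind
      rw [this]
      exact hB hadj.2
  · intro u v h
    have : (f u : Fin n) ∈ insert (f v : Fin n) D := by
      rw [← show insert (f u : Fin n) D = insert (f v : Fin n) D from h]
      exact mem_insert_self _ _
    exact hinj ((mem_insert.1 this).resolve_right (hfD u))
  · intro e e' h
    refine Subtype.ext (Sym2.ext fun v => ?_)
    rw [← hmem, ← hmem, h]
  -- If a vertex image equalled an edge image, both ends of the edge would be v, a loop.
  · rintro v ⟨e, he⟩ h
    induction e with
    | _ u w =>
      have h1 : ∀ x, x ∈ s(u, w) → x = v := by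
        intro x hx
        have := (hmem x ⟨s(u, w), he⟩).2 hx
        rw [← h] at this
        exact hinj ((mem_insert.1 this).resolve_right (hfD x))
      have h2 := h1 u (by simp)
      have h3 := h1 w (by simp)
      rw [h2, h3] at he
      exact G.loopless.irrefl _ he
  · intro v e h
    refine insert_subset ((hmem v e).2 h) subset_union_left

theorem card_link_pairs_le {F A B : Finset (Finset (Fin n))}
    (hF : IsPosetFree F (GraphPoset G)) (hA : A ⊆ F) (hB : B ⊆ F) {a C : ℝ}
    (hC : ∀ k : ℕ, 2 * (SimpleGraph.extremalNumber k G : ℝ) ≤ a * k ^ 2 + C * k)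
    (D : Finset (Fin n)) :
    (#{p ∈ (extensions A D).offDiag | insert p.1 (insert p.2 D) ∈ B} : ℝ) ≤
      a * (#(extensions A D) : ℝ) ^ 2 + C * #(extensions A D) := by
  classical
  have h := SimpleGraph.card_adj_pairs_le_of_free hC _ (hF.free_linkGraph hA hB D)
  rw [Fintype.card_coe] at h
  refine le_trans ?_ h
  norm_cast
  have hmem : ∀ p ∈ ({p ∈ (extensions A D).offDiag | insert p.1 (insert p.2 D) ∈ B} :
      Finset (Fin n × Fin n)), p.1 ∈ extensions A D ∧ p.2 ∈ extensions A D := by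
    intro p hp
    have := mem_offDiag.1 (mem_filter.1 hp).1
    exact ⟨this.1, this.2.1⟩
  refine card_le_card_of_forall_subsingleton
    (fun p (q : extensions A D × extensions A D) => (q.1 : Fin n) = p.1 ∧ (q.2 : Fin n) = p.2)
    ?_ ?_
  · intro p hp
    refine ⟨(⟨p.1, (hmem p hp).1⟩, ⟨p.2, (hmem p hp).2⟩), ?_, rfl, rfl⟩
    have h1 := mem_filter.1 hp
    have h2 := mem_offDiag.1 h1.1
    simp only [mem_filter, mem_univ, true_and]
    exact ⟨fun h => h2.2.2 (Subtype.ext_iff.1 h), h1.2⟩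
  · rintro q hq p ⟨hp, h1, h2⟩ p' ⟨hp', h1', h2'⟩
    exact Prod.ext (h1.symm.trans h1') (h2.symm.trans h2')

/-- Each full level has weight one. -/
theorem lubell_le_card_levels (p : ℕ → Prop) [DecidablePred p] :
    lubell ({S | p #S} : Finset (Finset (Fin n))) ≤ #{k ∈ range (n + 1) | p k} := by
  have := sum_powerset_apply_card (fun k => if p k then ((n.choose k : ℕ) : ℝ)⁻¹ else 0)
    (x := (univ : Finset (Fin n)))
  rw [powerset_univ, card_univ, Fintype.card_fin] at this
  rw [lubell, sum_filter, Fintype.card_fin, this, card_filter, Nat.cast_sum]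
  refine sum_le_sum fun k _ => ?_
  split_ifs
  · rw [nsmul_eq_mul]
    simpa using mul_inv_le_one
  · simp

theorem card_central_levels_le (n : ℕ) {δ : ℝ} (hδ : 0 ≤ δ) :
    (#{k ∈ range (n + 1) | |2 * ((k : ℕ) : ℝ) - n| ≤ δ * n} : ℝ) ≤ δ * n + 1 := by
  rcases ({k ∈ range (n + 1) | |2 * ((k : ℕ) : ℝ) - n| ≤ δ * n} : Finset ℕ).eq_empty_or_nonempty
    with h | h
  · rw [h]
    simp only [card_empty, Nat.cast_zero]
    positivity
  · have h1 := (mem_filter.1 (min'_mem _ h)).2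
    have h2 := (mem_filter.1 (max'_mem _ h)).2
    set a := min' _ h
    set b := max' _ h
    have hab : a ≤ b := min'_le _ _ (max'_mem _ h)
    have h3 : #{k ∈ range (n + 1) | |2 * ((k : ℕ) : ℝ) - n| ≤ δ * n} ≤ #(Icc a b) :=
      card_le_card fun k hk => mem_Icc.2 ⟨min'_le _ _ hk, le_max' _ _ hk⟩
    rw [Nat.card_Icc] at h3
    have h4 : (#{k ∈ range (n + 1) | |2 * ((k : ℕ) : ℝ) - n| ≤ δ * n} : ℝ) ≤ b + 1 - a := by
      have : #{k ∈ range (n + 1) | |2 * ((k : ℕ) : ℝ) - n| ≤ δ * n} + a ≤ b + 1 := by omega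
      have : (#{k ∈ range (n + 1) | |2 * ((k : ℕ) : ℝ) - n| ≤ δ * n} : ℝ) + a ≤ b + 1 := by
        exact_mod_cast this
      linarith
    have h5 := (abs_le.1 h1).1
    have h6 := (abs_le.1 h2).2
    linarith

end PosetFree

/-! ### Assembling the asymptotic bounds. -/

section Main

variable {V : Type*} {G : SimpleGraph V} {n : ℕ}

/-- The Lubell weight of a `P(G)`-free family of sets of nearly middle size. -/
theorem IsPosetFree.lubell_central_le [Finite V] {F : Finset (Finset (Fin n))}
    (hF : IsPosetFree F (GraphPoset G)) {δ : ℝ} (hδ0 : 0 ≤ δ) (hδ : δ ≤ 1 / 2)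
    (hFδ : ∀ S ∈ F, |2 * (#S : ℝ) - n| ≤ δ * n) {s : ℕ}
    (hs : s = Nat.card V + Nat.card G.edgeSet) (hm : 1 ≤ n / 4) (hsm : s < n / 4)
    {a C : ℝ} (ha : 0 ≤ a) (hC : 0 ≤ C)
    (hTuran : ∀ k : ℕ, 2 * (SimpleGraph.extremalNumber k G : ℝ) ≤ a * k ^ 2 + C * k) {x : ℝ}
    (hx : x = 1 / (n / 4 : ℕ)) :
    lubell F ≤ 1 + √((1 - s * x)⁻¹ * ((a + C * x) * ((1 - s * x)⁻¹ * (1 + x)) +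
      (1 - s * x)⁻¹ * x)) + (2 * (1 - s * x)⁻¹ + 1) * (s * x) + 8 * δ * s := by
  classical
  set m := n / 4 with hmdef
  have hm0 : (0 : ℝ) < m := by exact_mod_cast hm
  let M : Finset (Finset (Fin n)) := {S | |2 * (#S : ℝ) - n| ≤ δ * n}
  have hn4 : 4 * (m : ℝ) ≤ n := by exact_mod_cast (by omega : 4 * m ≤ n)
  -- Since m ≥ 1, n ≤ 4m + 3 ≤ 8m; this is the source of the 8 in the error term 8δs.
  have hn8 : (n : ℝ) ≤ 8 * m := by exact_mod_cast (by omega : n ≤ 8 * m)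
  have hMc : IsCentral m M := by
    intro S hS
    have h1 := abs_le.1 (mem_filter.1 hS).2
    have h2 : δ * n ≤ n / 2 := by nlinarith
    rw [Fintype.card_fin]
    constructor
    · have : (m : ℝ) ≤ #S := by linarith
      exact_mod_cast this
    · have : (#S : ℝ) + m ≤ n := by linarith
      exact_mod_cast this
  have hFM : F ⊆ M := fun S hS => mem_filter.2 ⟨mem_univ _, hFδ S hS⟩
  have hbetween : ∀ A ∈ F, ∀ B ∈ F, ∀ S, A ⊂ S → S ⊂ B → S ∈ M := by
    intro A hA B hB S hAS hSB
    have h1 := abs_le.1 (hFδ A hA)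
    have h2 := abs_le.1 (hFδ B hB)
    have h3 : (#A : ℝ) ≤ #S := by exact_mod_cast card_le_card hAS.subset
    have h4 : (#S : ℝ) ≤ #B := by exact_mod_cast card_le_card hSB.subset
    exact mem_filter.2 ⟨mem_univ _, abs_le.2 ⟨by linarith [h1.1], by linarith [h2.2]⟩⟩
  have hfew := hF.few_below_or_few_above
  rw [← hs] at hfew
  -- Members with few others on both sides go to A; those of B have many below, hence few above.
  let A : Finset (Finset (Fin n)) := {S ∈ F | #{T ∈ F | T ⊂ S} ≤ s}
  let B : Finset (Finset (Fin n)) := {S ∈ F | ¬ #{T ∈ F | T ⊂ S} ≤ s}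
  have key := lubell_le_of_link (F := F) (A := A) (B := B) hm hsm (hMc.mono hFM) hMc hbetween
    hfew (disjoint_filter_filter_not _ _ _) (filter_union_filter_not_eq _ _).symm
    (fun S hS => (mem_filter.1 hS).2)
    (fun S hS => (hfew S).resolve_left (mem_filter.1 hS).2) ha hC
    (card_link_pairs_le hF (filter_subset _ _) (filter_subset _ _) hTuran)
  have hML : lubell M ≤ δ * n + 1 :=
    (lubell_le_card_levels (fun k => |2 * (k : ℝ) - n| ≤ δ * n)).trans
      (card_central_levels_le n hδ0)
  have hsx : (s : ℝ) / m = s * x := by rw [hx]; ring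
  have hCx : C / m = C * x := by rw [hx]; ring
  have hMs : lubell M * (s / m : ℝ) ≤ 8 * δ * s + s * x := by
    calc lubell M * (s / m : ℝ) ≤ (δ * (8 * m) + 1) * (s / m) := by
          gcongr
          exact hML.trans (by gcongr)
      _ = 8 * δ * s + s / m := by field_simp
      _ = _ := by rw [hsx]
  rw [hsx, hCx, ← hx, div_eq_mul_one_div _ (m : ℝ), ← hx] at key
  rw [hsx] at hMs
  linarith

theorem La_le_of_forall {H : Type*} [PartialOrder H] {x : ℝ} (hx : 0 ≤ x)
    (h : ∀ F : Finset (Finset (Fin n)), IsPosetFree F H → (#F : ℝ) ≤ x) : (La n H : ℝ) ≤ x := by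
  classical
  refine (Nat.cast_le.2 (?_ : La n H ≤ ⌊x⌋₊)).trans (Nat.floor_le hx)
  exact Finset.sup_le fun F hF => Nat.le_floor (h F (mem_filter.1 hF).2)

theorem tendsto_lubell_bound (s a C δ : ℝ) :
    Tendsto (fun x : ℝ => 1 + √((1 - s * x)⁻¹ * ((a + C * x) * ((1 - s * x)⁻¹ * (1 + x)) +
      (1 - s * x)⁻¹ * x)) + (2 * (1 - s * x)⁻¹ + 1) * (s * x) + 8 * δ * s) (𝓝 0)
      (𝓝 (1 + √a + 8 * δ * s)) := by
  have h : ContinuousAt (fun x : ℝ => 1 + √((1 - s * x)⁻¹ *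
      ((a + C * x) * ((1 - s * x)⁻¹ * (1 + x)) +
      (1 - s * x)⁻¹ * x)) + (2 * (1 - s * x)⁻¹ + 1) * (s * x) + 8 * δ * s) 0 := by
    have h0 : ContinuousAt (fun x : ℝ => (1 - s * x)⁻¹) 0 :=
      ContinuousAt.inv₀ (by fun_prop) (by simp)
    fun_prop
  simpa using h.tendsto

/-- The asymptotic upper bound for a graph that is colorable with `r + 1` colors. -/
theorem eventually_La_le_of_colorable [Finite V] {r : ℕ} (hr : 1 ≤ r)
    (hG : G.Colorable (r + 1)) {η : ℝ} (hη : 0 < η) :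
    ∀ᶠ n : ℕ in atTop, (La n (GraphPoset G) : ℝ) ≤
      (1 + √(1 - 1 / r) + η) * n.choose (n / 2) := by
  classical
  set s := Nat.card V + Nat.card G.edgeSet with hs
  -- A square, so that it costs at most η / 8 outside the root. With 8δs ≤ η / 8 the limit stays
  -- below the target plus η / 2; the other η / 2 pays for the far sets.
  have hε : 0 < (η / 8) ^ 2 := by positivity
  obtain ⟨C, hC0, hC⟩ := SimpleGraph.exists_two_mul_extremalNumber_le hr hG hε
  have hr1 : (1 : ℝ) / r ≤ 1 := by
    rw [div_le_one (by positivity)]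
    exact_mod_cast hr
  set δ : ℝ := min (1 / 2) (η / (64 * (s + 1))) with hδ
  have hδ0 : 0 < δ := lt_min (by norm_num) (by positivity)
  have hδs : 8 * δ * s ≤ η / 8 := by
    have h1 : δ * (64 * (s + 1)) ≤ η :=
      (le_div_iff₀ (by positivity)).1 (min_le_right _ _)
    nlinarith
  have hsqrt : √(1 - 1 / r + (η / 8) ^ 2) ≤ √(1 - 1 / (r : ℝ)) + η / 8 := by
    refine Real.sqrt_le_iff.2 ⟨by positivity, ?_⟩
    have := Real.sq_sqrt (sub_nonneg.2 hr1)
    nlinarith [Real.sqrt_nonneg (1 - 1 / (r : ℝ))]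
  have hquarter : Tendsto (fun n : ℕ => n / 4) atTop atTop :=
    Nat.tendsto_div_const_atTop (by norm_num)
  have hx : Tendsto (fun n : ℕ => 1 / ((n / 4 : ℕ) : ℝ)) atTop (𝓝 0) :=
    tendsto_one_div_atTop_nhds_zero_nat.comp hquarter
  have hlim := (tendsto_lubell_bound s (1 - 1 / r + (η / 8) ^ 2) C δ).comp hx
  have hlt : 1 + √(1 - 1 / r + (η / 8) ^ 2) + 8 * δ * s < 1 + √(1 - 1 / (r : ℝ)) + η / 2 := by
    linarith
  filter_upwards [hlim.eventually_lt_const hlt, hquarter.eventually_gt_atTop s,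
    eventually_card_far_from_middle_le hδ0 (half_pos hη)] with n hn hns hfar
  refine La_le_of_forall (by positivity) fun F hF => ?_
  have hcentral := (hF.mono
    (filter_subset (fun S => |2 * (#S : ℝ) - n| ≤ δ * n) F)).lubell_central_le
    hδ0.le (min_le_left _ _) (fun S hS => (mem_filter.1 hS).2) hs (by omega) hns
    (by linarith) hC0 hC rfl
  have h1 := card_le_choose_mul_lubell (F.filter fun S => |2 * (#S : ℝ) - n| ≤ δ * n)
  rw [Fintype.card_fin] at h1
  have h2 : (#F : ℝ) ≤ #(F.filter fun S => |2 * (#S : ℝ) - n| ≤ δ * n) +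
      #{S : Finset (Fin n) | δ * n < |2 * (#S : ℝ) - n|} := by
    rw [← card_filter_add_card_filter_not (s := F) (p := fun S => |2 * (#S : ℝ) - n| ≤ δ * n)]
    push_cast
    gcongr
    intro S hS
    exact mem_filter.2 ⟨mem_univ _, not_le.1 (mem_filter.1 hS).2⟩
  have h3 := hcentral.trans hn.le
  calc (#F : ℝ) ≤ n.choose (n / 2) * (1 + √(1 - 1 / (r : ℝ)) + η / 2) +
        η / 2 * n.choose (n / 2) := by
        refine h2.trans (add_le_add (h1.trans ?_) hfar)
        gcongr
    _ = _ := by ring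

/-- The middle layer is `P(G)`-free when `G` has an edge. -/
theorem choose_middle_le_La (hG : G.edgeSet.Nonempty) (n : ℕ) :
    n.choose (n / 2) ≤ La n (GraphPoset G) := by
  classical
  have hcard : #(powersetCard (n / 2) (univ : Finset (Fin n))) = n.choose (n / 2) := by
    rw [card_powersetCard, card_univ, Fintype.card_fin]
  rw [← hcard]
  refine le_sup (f := Finset.card) (mem_filter.2 ⟨mem_univ _, ?_⟩)
  rintro ⟨f, hf, hle⟩
  obtain ⟨e, he⟩ := hG
  induction e with
  | _ u v =>
    have h1 : (GraphPoset.vertex u : GraphPoset G) ≤ .edge ⟨s(u, v), he⟩ :=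
      GraphPoset.Le.incident u _ (by simp)
    have h2 : (f (.vertex u)).1 ⊆ (f (.edge ⟨s(u, v), he⟩)).1 := hle _ _ h1
    have h3 : (f (.vertex u)).1 = (f (.edge ⟨s(u, v), he⟩)).1 := by
      refine eq_of_subset_of_card_le h2 ?_
      rw [(mem_powersetCard.1 (f (.vertex u)).2).2,
        (mem_powersetCard.1 (f (.edge ⟨s(u, v), he⟩)).2).2]
    exact absurd (hf (Subtype.ext h3)) (by simp)

theorem exists_tendsto_zero_of_eventually_le {u b : ℕ → ℝ} {c : ℝ} (hb : ∀ n, 0 < b n)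
    (h : ∀ η > 0, ∀ᶠ n in atTop, u n ≤ (c + η) * b n) :
    ∃ ε : ℕ → ℝ, Tendsto ε atTop (𝓝 0) ∧ ∀ n, u n ≤ (c + ε n) * b n := by
  -- Truncation at 0 is needed: u n / b n may stay well below c.
  refine ⟨fun n => max 0 (u n / b n - c), ?_, fun n => ?_⟩
  · refine tendsto_order.2 ⟨fun a ha => .of_forall fun n => ha.trans_le (le_max_left _ _),
      fun a ha => ?_⟩
    filter_upwards [h (a / 2) (half_pos ha)] with n hn
    have := (div_le_iff₀ (hb n)).2 hn
    exact max_lt ha (by linarith)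
  · rw [← div_le_iff₀ (hb n)]
    linarith [le_max_right 0 (u n / b n - c)]

end Main

end GraphPosetBound

theorem theorem4 {V : Type*} [Finite V] (G : SimpleGraph V) (hG : G.edgeSet.Nonempty) :
    (∃ ε : ℕ → ℝ, Tendsto ε atTop (𝓝 0) ∧
      ∀ n : ℕ, (La n (GraphPoset G) : ℝ) ≤
        (1 + √(1 - 1 / ((G.chromaticNumber.toNat : ℝ) - 1)) + ε n) *
          (n.choose (n / 2) : ℝ)) ∧
    (G.IsBipartite →
      ∃ ε : ℕ → ℝ, Tendsto ε atTop (𝓝 0) ∧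
        ∀ n : ℕ, (La n (GraphPoset G) : ℝ) = (1 + ε n) * (n.choose (n / 2) : ℝ)) := by
  have hpos : ∀ n : ℕ, (0 : ℝ) < n.choose (n / 2) := fun n => by
    exact_mod_cast Nat.choose_pos (Nat.div_le_self n 2)
  have hcol : G.Colorable G.chromaticNumber.toNat := G.colorable_chromaticNumber_of_fintype
  have htwo : 2 ≤ G.chromaticNumber.toNat := by
    have h1 := SimpleGraph.two_le_chromaticNumber_iff_ne_bot.2 (SimpleGraph.edgeSet_nonempty.1 hG)
    exact ENat.toNat_le_toNat h1 (SimpleGraph.chromaticNumber_ne_top_iff_exists.2 ⟨_, hcol⟩)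
  obtain ⟨r, hr⟩ : ∃ r, G.chromaticNumber.toNat = r + 1 := ⟨_, (Nat.sub_add_cancel (by omega)).symm⟩
  constructor
  · refine exists_tendsto_zero_of_eventually_le hpos fun η hη => ?_
    have := eventually_La_le_of_colorable (r := r) (by omega) (hr ▸ hcol) hη
    rw [hr]
    simpa using this
  · intro hbip
    refine ⟨fun n => La n (GraphPoset G) / n.choose (n / 2) - 1, ?_, fun n => ?_⟩
    · refine tendsto_order.2 ⟨fun a ha => .of_forall fun n => ha.trans_le ?_, fun a ha => ?_⟩
      · rw [sub_nonneg, one_le_div (hpos n)]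
        exact_mod_cast choose_middle_le_La hG n
      -- For r = 1 the root is √0; taking a / 2 makes the final inequality strict.
      · filter_upwards [eventually_La_le_of_colorable (r := 1) le_rfl hbip (half_pos ha)] with n hn
        have := (div_le_iff₀ (hpos n)).2 hn
        simp only [Nat.cast_one, div_one, sub_self, Real.sqrt_zero, add_zero] at this
        linarith
    · have := (hpos n).ne'
      field_simp
      ring
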